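/- Let $X$ be a complex Banach space, $T$ a bounded linear operator on $X$, and $T^*$ its Banach-space adjoint on the dual $X^*$. Then $$\sigma_{rgD}(T)=\sigma_{pBlF}(T)\cup S(T^*)=\sigma_{pBlW}(T)\cup S(T^*).$$ Here the following definitions are used. - $S(T^*)$ is the set of $\lambda\in\mathbb{C}$ at which $T^*$ fails to have the single-valued extension property. An operator $A$ has this property at $\lambda$ if, for every connected open neighbourhood $U$ of $\lambda$, the only analytic function $f$ on $U$ with $(A-zI)f(z)=0$ for all $z\in U$ is $f\equiv 0$. - $\sigma_{rgD}(T)$ is the set of $\lambda\in\mathbb{C}$ such that $T-\lambda I$ is not right generalized Drazin invertible. A bounded operator $A$ on $X$ is right generalized Drazin invertible if its analytic core $K(A)$ is closed and there is a closed $A$-invariant subspace $N$ with $X=K(A)\oplus N$ and $N\subseteq H_0(A)$. Here $K(A)$ is the set of $x$ for which there are $\delta>0$ and a sequence $(x_n)_{n\ge 0}$ with $x_0=x$, $Ax_{n+1}=x_n$ and $\|x_n\|\le\delta^n\|x\|$ for all $n\ge 0$, and $H_0(A)=\{x:\lim_{n\to\infty}\|A^nx\|^{1/n}=0\}$. - $\sigma_{pBlF}(T)$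 (resp. $\sigma_{pBlW}(T)$) is the set of $\lambda\in\mathbb{C}$ for which there is no pair of closed $(T-\lambda I)$-invariant subspaces $X_1,X_2$ with $X=X_1\oplus X_2$ such that $(T-\lambda I)|_{X_1}$ is lower semi-Fredholm (resp. lower semi-Fredholm of index $\ge 0$) and $(T-\lambda I)|_{X_2}$ is quasi-nilpotent, i.e. has spectral radius $0$. An operator $A$ is lower semi-Fredholm if $\operatorname{codim}R(A)<\infty$; its index is $\dim N(A)-\operatorname{codim}R(A)\in\mathbb{Z}\cup\{+\infty\}$. -/

import Mathlib

open Filter Topology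

noncomputable section

namespace PseudoFredholm

section Definitions

variable {X : Type*} [NormedAddCommGroup X] [NormedSpace ℂ X]

/-- The (linear, not conjugate-linear) Banach space adjoint `T* : X* → X*`, `T* φ = φ ∘ T`. -/
def banachAdjoint (T : X →L[ℂ] X) : StrongDual ℂ X →L[ℂ] StrongDual ℂ X :=
  ContinuousLinearMap.precomp ℂ T

/-- The operator `T - l I`. -/
def shift (T : X →L[ℂ] X) (l : ℂ) : X →L[ℂ] X :=
  T - l • ContinuousLinearMap.id ℂ X

/-- `T` is quasi-nilpotent: its spectral radius is zero. The operator on the zero space, which has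
empty spectrum, is quasi-nilpotent. -/
def IsQuasiNilpotent (T : X →L[ℂ] X) : Prop :=
  spectralRadius ℂ T = 0

/-- The quasi-nilpotent part `H₀(T)`: all `x` with `‖Tⁿ x‖ ^ (1/n) → 0`. -/
def quasiNilpotentPart (T : X →L[ℂ] X) : Set X :=
  {x | Tendsto (fun n : ℕ => ‖(T ^ n) x‖ ^ (1 / (n : ℝ))) atTop (𝓝 0)}

/-- `x` lies in the analytic core of `T`: there are a sequence `u` and `δ > 0` with `u 0 = x`,
`T (u (n + 1)) = u n` and `‖u n‖ ≤ δ ^ n * ‖x‖` for all `n`. -/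
def MemAnalyticCore (T : X →L[ℂ] X) (x : X) : Prop :=
  ∃ (u : ℕ → X) (δ : ℝ), 0 < δ ∧ u 0 = x ∧ (∀ n, T (u (n + 1)) = u n) ∧
    ∀ n, ‖u n‖ ≤ δ ^ n * ‖x‖

theorem memAnalyticCore_zero (T : X →L[ℂ] X) : MemAnalyticCore T 0 :=
  ⟨fun _ => 0, 1, one_pos, rfl, fun _ => map_zero T, fun n => by simp⟩

theorem memAnalyticCore_add (T : X →L[ℂ] X) {x y : X} (hx : MemAnalyticCore T x)
    (hy : MemAnalyticCore T y) : MemAnalyticCore T (x + y) := by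
  by_cases h : x + y = 0
  · rw [h]; exact memAnalyticCore_zero T
  obtain ⟨u, a, ha, hu0, hu, hub⟩ := hx
  obtain ⟨v, b, hb, hv0, hv, hvb⟩ := hy
  have hpos : 0 < ‖x + y‖ := norm_pos_iff.mpr h
  set c : ℝ := max 1 ((‖x‖ + ‖y‖) / ‖x + y‖) with hc
  have hc1 : 1 ≤ c := le_max_left _ _
  have hc2 : ‖x‖ + ‖y‖ ≤ c * ‖x + y‖ := (div_le_iff₀ hpos).mp (le_max_right _ _)
  refine ⟨fun n => u n + v n, max a b * c, ?_, ?_, ?_, ?_⟩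
  · exact mul_pos (lt_max_of_lt_left ha) (by linarith)
  · simp [hu0, hv0]
  · intro n; simp [hu, hv]
  · intro n
    rcases Nat.eq_zero_or_pos n with rfl | hn
    · simp [hu0, hv0]
    have hm : 0 ≤ max a b ^ n := pow_nonneg (le_max_of_le_left ha.le) n
    have h1 : a ^ n ≤ max a b ^ n := pow_le_pow_left₀ ha.le (le_max_left _ _) n
    have h2 : b ^ n ≤ max a b ^ n := pow_le_pow_left₀ hb.le (le_max_right _ _) n
    have h3 : c ≤ c ^ n := le_self_pow₀ hc1 hn.ne'
    calc ‖u n + v n‖ ≤ ‖u n‖ + ‖v n‖ := norm_add_le _ _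
      _ ≤ a ^ n * ‖x‖ + b ^ n * ‖y‖ := add_le_add (hub n) (hvb n)
      _ ≤ max a b ^ n * ‖x‖ + max a b ^ n * ‖y‖ := by gcongr
      _ = max a b ^ n * (‖x‖ + ‖y‖) := by ring
      _ ≤ max a b ^ n * (c * ‖x + y‖) := by gcongr
      _ ≤ max a b ^ n * (c ^ n * ‖x + y‖) := by gcongr
      _ = (max a b * c) ^ n * ‖x + y‖ := by rw [mul_pow]; ring

theorem memAnalyticCore_smul (T : X →L[ℂ] X) (r : ℂ) {x : X} (hx : MemAnalyticCore T x) :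
    MemAnalyticCore T (r • x) := by
  obtain ⟨u, a, ha, hu0, hu, hub⟩ := hx
  refine ⟨fun n => r • u n, a, ha, by simp [hu0], fun n => by simp [hu], fun n => ?_⟩
  rw [norm_smul, norm_smul]
  calc ‖r‖ * ‖u n‖ ≤ ‖r‖ * (a ^ n * ‖x‖) := by gcongr; exact hub n
    _ = a ^ n * (‖r‖ * ‖x‖) := by ring

/-- The analytic core `K(T)`, a (not necessarily closed) linear subspace of `X`. -/
def analyticCore (T : X →L[ℂ] X) : Submodule ℂ X where
  carrier := {x | MemAnalyticCore T x}
  zero_mem' := memAnalyticCore_zero T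
  add_mem' hx hy := memAnalyticCore_add T hx hy
  smul_mem' r _ hx := memAnalyticCore_smul T r hx

/-- `T` has the single valued extension property at `l`: on every connected open neighbourhood `U`
of `l`, the only analytic `f : U → X` with `(T - z I) f z = 0` on `U` is the zero function. -/
def HasSVEPAt (T : X →L[ℂ] X) (l : ℂ) : Prop :=
  ∀ U : Set ℂ, IsOpen U → IsConnected U → l ∈ U → ∀ f : ℂ → X, AnalyticOnNhd ℂ f U →
    (∀ z ∈ U, shift T z (f z) = 0) → ∀ z ∈ U, f z = 0

/-- `S(T)`: the set of points at which `T` fails to have the single valued extension property. -/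
def svepFailureSet (T : X →L[ℂ] X) : Set ℂ :=
  {l | ¬ HasSVEPAt T l}

/-- `T` is lower semi-Fredholm: its range has finite codimension. -/
def IsLowerSemiFredholm (T : X →L[ℂ] X) : Prop :=
  FiniteDimensional ℂ (X ⧸ T.range)

/-- The index `dim N(T) - codim R(T)` of a semi-Fredholm operator, as an extended real number. -/
def fredholmIndex (T : X →L[ℂ] X) : EReal :=
  (((Module.rank ℂ T.ker).toENat : ENNReal) : EReal) -
    (((Module.rank ℂ (X ⧸ T.range)).toENat : ENNReal) : EReal)

/-- `T` is pseudo lower semi B-Fredholm: `X = X₁ ⊕ X₂` with closed `T`-invariant subspaces such that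
`T|X₁` is lower semi-Fredholm and `T|X₂` is quasi-nilpotent. -/
def IsPseudoLowerSemiBFredholm (T : X →L[ℂ] X) : Prop :=
  ∃ (X₁ X₂ : Submodule ℂ X) (h₁ : ∀ x ∈ X₁, T x ∈ X₁) (h₂ : ∀ x ∈ X₂, T x ∈ X₂),
    IsClosed (X₁ : Set X) ∧ IsClosed (X₂ : Set X) ∧ IsCompl X₁ X₂ ∧
      IsLowerSemiFredholm (T.restrict h₁) ∧ IsQuasiNilpotent (T.restrict h₂)

/-- `T` belongs to `pBlW(X)`: `X = X₁ ⊕ X₂` with closed `T`-invariant subspaces such that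
`T|X₁` is lower semi-Fredholm of index `≥ 0` and `T|X₂` is quasi-nilpotent. -/
def IsPseudoLowerSemiBWeyl (T : X →L[ℂ] X) : Prop :=
  ∃ (X₁ X₂ : Submodule ℂ X) (h₁ : ∀ x ∈ X₁, T x ∈ X₁) (h₂ : ∀ x ∈ X₂, T x ∈ X₂),
    IsClosed (X₁ : Set X) ∧ IsClosed (X₂ : Set X) ∧ IsCompl X₁ X₂ ∧
      IsLowerSemiFredholm (T.restrict h₁) ∧ 0 ≤ fredholmIndex (T.restrict h₁) ∧
      IsQuasiNilpotent (T.restrict h₂)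

/-- `T` is right generalized Drazin invertible: the analytic core `K(T)` is closed and has a closed
`T`-invariant complement `N` contained in the quasi-nilpotent part `H₀(T)`. -/
def IsRightGeneralizedDrazin (T : X →L[ℂ] X) : Prop :=
  IsClosed (analyticCore T : Set X) ∧
    ∃ N : Submodule ℂ X, IsClosed (N : Set X) ∧ IsCompl (analyticCore T) N ∧
      (∀ x ∈ N, T x ∈ N) ∧ (N : Set X) ⊆ quasiNilpotentPart T

/-- The pseudo lower semi B-Fredholm spectrum. -/
def spectrumPBLF (T : X →L[ℂ] X) : Set ℂ :=
  {l | ¬ IsPseudoLowerSemiBFredholm (shift T l)}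

/-- The pseudo lower semi B-Weyl spectrum. -/
def spectrumPBLW (T : X →L[ℂ] X) : Set ℂ :=
  {l | ¬ IsPseudoLowerSemiBWeyl (shift T l)}

/-- The right generalized Drazin spectrum. -/
def spectrumRGD (T : X →L[ℂ] X) : Set ℂ :=
  {l | ¬ IsRightGeneralizedDrazin (shift T l)}

end Definitions

end PseudoFredholm

end

noncomputable section

namespace PseudoFredholm

/-! ### Growth of powers and quasi-nilpotency -/

section QuasiNilpotent

/-! Write `A = T - l`. If `A` is right generalized Drazin invertible, it maps `K(A)` onto itself, so
`K(A) ⊕ N` is a pseudo B-Weyl decomposition. It also forces SVEP of the adjoint at `l`: near `l`,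
local solutions die on `K(A)` by the open mapping theorem and on `N` by quasi-nilpotency.

Conversely, let `A` be lower semi-Fredholm on `X₁` and quasi-nilpotent on `X₂`, and let `G` be the
union of the kernels of the powers of `A|X₁`. If `R(A|X₁) + G ≠ X₁`, some nonzero functional
vanishes on this sum. Vanishing on `G` lets it be pulled back through `A` again and again with
geometric bounds (`exists_functionals`), and the resulting power series refutes SVEP
(`not_hasSVEPAt_banachAdjoint`). Otherwise finite codimension gives `R(A|X₁) + ker (A|X₁)^d = X₁`
for some `d`. Then `M = R((A|X₁)^d)` is mapped onto itself and has a finite-dimensional invariant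
complement `F` on which `A` is nilpotent (`exists_decomposition`), so `M ⊕ (X₂ ⊕ F)` is the
decomposition sought. -/

theorem tendsto_rpow_one_div_zero_iff {a : ℕ → ℝ} (ha : ∀ n, 0 ≤ a n) :
    Tendsto (fun n : ℕ => a n ^ (1 / (n : ℝ))) atTop (𝓝 0) ↔
      ∀ ε > 0, ∀ᶠ n in atTop, a n ≤ ε ^ n := by
  have key : ∀ ε > 0, ∀ n : ℕ, n ≠ 0 → (a n ^ (1 / (n : ℝ)) ≤ ε ↔ a n ≤ ε ^ n) := by
    intro ε hε n hn
    rw [one_div, Real.rpow_inv_le_iff_of_pos (ha n) hε.le (by positivity), Real.rpow_natCast]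
  constructor
  · intro h ε hε
    filter_upwards [h.eventually_le_const hε, eventually_ne_atTop 0] with n h1 h2
    exact (key ε hε n h2).1 h1
  · intro h
    rw [Metric.tendsto_nhds]
    intro ε hε
    filter_upwards [h (ε / 2) (half_pos hε), eventually_ne_atTop 0] with n h1 h2
    rw [Real.dist_eq, sub_zero, abs_of_nonneg (Real.rpow_nonneg (ha n) _)]
    exact ((key _ (half_pos hε) n h2).2 h1).trans_lt (half_lt_self hε)

variable {X : Type*} [NormedAddCommGroup X] [NormedSpace ℂ X]

theorem mem_quasiNilpotentPart_iff {T : X →L[ℂ] X} {x : X} :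
    x ∈ quasiNilpotentPart T ↔ ∀ ε > 0, ∀ᶠ n in atTop, ‖(T ^ n) x‖ ≤ ε ^ n :=
  tendsto_rpow_one_div_zero_iff fun _ => norm_nonneg _

variable [CompleteSpace X]

theorem isQuasiNilpotent_iff {T : X →L[ℂ] X} :
    IsQuasiNilpotent T ↔ ∀ ε > 0, ∀ᶠ n in atTop, ‖T ^ n‖ ≤ ε ^ n := by
  rw [← tendsto_rpow_one_div_zero_iff fun _ => norm_nonneg _, IsQuasiNilpotent]
  have h := spectrum.pow_norm_pow_one_div_tendsto_nhds_spectralRadius T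
  constructor
  · intro h0
    rw [h0] at h
    refine ((ENNReal.tendsto_toReal ENNReal.zero_ne_top).comp h).congr fun n => ?_
    exact ENNReal.toReal_ofReal (by positivity)
  · intro h0
    have h1 := ENNReal.tendsto_ofReal h0
    rw [ENNReal.ofReal_zero] at h1
    exact tendsto_nhds_unique h h1

/-- By the uniform boundedness principle, an operator whose quasi-nilpotent part is the whole space
is quasi-nilpotent. -/
theorem isQuasiNilpotent_of_forall_mem {T : X →L[ℂ] X} (h : ∀ x, x ∈ quasiNilpotentPart T) :
    IsQuasiNilpotent T := by
  rw [isQuasiNilpotent_iff]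
  intro ε hε
  -- Working with `ε / 2` leaves a factor `2 ^ n` that eventually exceeds the Banach–Steinhaus
  -- constant.
  have hδ : 0 < ε / 2 := half_pos hε
  obtain ⟨C, hC⟩ := banach_steinhaus (g := fun n : ℕ => ((((ε / 2) ^ n)⁻¹ : ℝ) : ℂ) • T ^ n) (by
    intro x
    have hb : IsBoundedUnder (· ≤ ·) atTop
        fun n : ℕ => ‖(((((ε / 2) ^ n)⁻¹ : ℝ) : ℂ) • T ^ n) x‖ := by
      refine ⟨1, ?_⟩
      rw [eventually_map]
      filter_upwards [mem_quasiNilpotentPart_iff.1 (h x) _ hδ] with n hn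
      rw [smul_apply, norm_smul, Complex.norm_real, Real.norm_eq_abs,
        abs_of_pos (by positivity), inv_mul_le_iff₀ (by positivity), mul_one]
      exact hn
    obtain ⟨C, hC⟩ := hb.bddAbove_range
    exact ⟨C, fun n => hC ⟨n, rfl⟩⟩)
  filter_upwards [(tendsto_pow_atTop_atTop_of_one_lt (one_lt_two : (1 : ℝ) < 2)).eventually_ge_atTop C]
    with n hn
  have h1 := hC n
  rw [norm_smul, Complex.norm_real, Real.norm_eq_abs, abs_of_pos (by positivity),
    inv_mul_le_iff₀ (by positivity)] at h1
  calc ‖T ^ n‖ ≤ (ε / 2) ^ n * C := h1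
    _ ≤ (ε / 2) ^ n * 2 ^ n := by gcongr
    _ = ε ^ n := by rw [← mul_pow]; congr 1; ring

theorem IsQuasiNilpotent.mem_quasiNilpotentPart {T : X →L[ℂ] X} (h : IsQuasiNilpotent T) (x : X) :
    x ∈ quasiNilpotentPart T := by
  rw [mem_quasiNilpotentPart_iff]
  intro ε hε
  filter_upwards [isQuasiNilpotent_iff.1 h (ε / 2) (half_pos hε),
    (tendsto_pow_atTop_atTop_of_one_lt (one_lt_two : (1 : ℝ) < 2)).eventually_ge_atTop ‖x‖]
    with n h1 h2
  calc ‖(T ^ n) x‖ ≤ ‖T ^ n‖ * ‖x‖ := (T ^ n).le_opNorm x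
    _ ≤ (ε / 2) ^ n * 2 ^ n := by gcongr
    _ = ε ^ n := by rw [← mul_pow]; congr 1; ring

theorem IsQuasiNilpotent.surjective_sub_smul {T : X →L[ℂ] X} (h : IsQuasiNilpotent T) {z : ℂ}
    (hz : z ≠ 0) : Function.Surjective (T - z • ContinuousLinearMap.id ℂ X) := by
  have h1 : z ∈ resolventSet ℂ T := by
    apply spectrum.mem_resolventSet_of_spectralRadius_lt
    rw [show spectralRadius ℂ T = 0 from h]
    simpa using hz
  have h2 : IsUnit (T - z • ContinuousLinearMap.id ℂ X) := by
    have := (spectrum.mem_resolventSet_iff.1 h1).neg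
    rwa [neg_sub, Algebra.algebraMap_eq_smul_one] at this
  exact (ContinuousLinearMap.isUnit_iff_bijective.1 h2).2

end QuasiNilpotent

/-! ### Analytic core and invariant decompositions -/

section AnalyticCore

variable {X : Type*} [NormedAddCommGroup X] [NormedSpace ℂ X] {T : X →L[ℂ] X}

/-- Enlarging `δ` by the factor `max 1 (C / ‖x‖)` absorbs `C` for `n ≥ 1`; the bound at `n = 0` is
automatic. -/
theorem mem_analyticCore_of_bound {x : X} {u : ℕ → X} {C δ : ℝ} (hδ : 0 < δ) (h0 : u 0 = x)
    (hu : ∀ n, T (u (n + 1)) = u n) (hb : ∀ n, ‖u n‖ ≤ C * δ ^ n) : x ∈ analyticCore T := by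
  rcases eq_or_ne x 0 with rfl | hx
  · exact zero_mem _
  have hx' : 0 < ‖x‖ := norm_pos_iff.2 hx
  set c := max 1 (C / ‖x‖)
  have hc : 1 ≤ c := le_max_left _ _
  have hc2 : C ≤ c * ‖x‖ := (div_le_iff₀ hx').1 (le_max_right _ _)
  refine ⟨u, c * δ, by positivity, h0, hu, fun n => ?_⟩
  rcases eq_or_ne n 0 with rfl | hn
  · simp [h0]
  calc ‖u n‖ ≤ C * δ ^ n := hb n
    _ ≤ c * ‖x‖ * δ ^ n := by gcongr
    _ ≤ c ^ n * ‖x‖ * δ ^ n := by gcongr; exact le_self_pow₀ hc hn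
    _ = (c * δ) ^ n * ‖x‖ := by rw [mul_pow]; ring

theorem map_mem_analyticCore {x : X} (hx : x ∈ analyticCore T) : T x ∈ analyticCore T := by
  obtain ⟨u, δ, hδ, h0, hu, hb⟩ := hx
  refine mem_analyticCore_of_bound (u := fun n => T (u n)) (C := ‖T‖ * ‖x‖) hδ (by simp [h0])
    (fun n => by rw [hu]) fun n => ?_
  calc ‖T (u n)‖ ≤ ‖T‖ * (δ ^ n * ‖x‖) := T.le_opNorm_of_le (hb n)
    _ = ‖T‖ * ‖x‖ * δ ^ n := by ring

theorem exists_map_eq_of_mem_analyticCore {x : X} (hx : x ∈ analyticCore T) :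
    ∃ y ∈ analyticCore T, T y = x := by
  obtain ⟨u, δ, hδ, h0, hu, hb⟩ := hx
  refine ⟨u 1, mem_analyticCore_of_bound (u := fun n => u (n + 1)) (C := δ * ‖x‖) hδ rfl
    (fun n => hu _) fun n => ?_, (hu 0).trans h0⟩
  calc ‖u (n + 1)‖ ≤ δ ^ (n + 1) * ‖x‖ := hb _
    _ = δ * ‖x‖ * δ ^ n := by ring

theorem restrict_pow_apply {N : Submodule ℂ X} (h : ∀ x ∈ N, T x ∈ N) (n : ℕ) (x : N) :
    (((T.restrict h) ^ n) x : X) = (T ^ n) x := by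
  induction n generalizing x with
  | zero => rfl
  | succ n ih => rw [pow_succ, pow_succ]; exact ih _

theorem mem_quasiNilpotentPart_restrict {N : Submodule ℂ X} (h : ∀ x ∈ N, T x ∈ N) (x : N) :
    x ∈ quasiNilpotentPart (T.restrict h) ↔ (x : X) ∈ quasiNilpotentPart T := by
  rw [mem_quasiNilpotentPart_iff, mem_quasiNilpotentPart_iff]
  simp_rw [← restrict_pow_apply h, Submodule.norm_coe]

variable [CompleteSpace X]

theorem isQuasiNilpotent_restrict {N : Submodule ℂ X} (hN : IsClosed (N : Set X))
    (h : ∀ x ∈ N, T x ∈ N) (hq : (N : Set X) ⊆ quasiNilpotentPart T) :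
    IsQuasiNilpotent (T.restrict h) := by
  have := hN.completeSpace_coe
  exact isQuasiNilpotent_of_forall_mem fun x => (mem_quasiNilpotentPart_restrict h x).2 (hq x.2)

/-- A closed subspace that the operator maps onto itself lies in the analytic core. -/
theorem le_analyticCore {M : Submodule ℂ X} (hM : IsClosed (M : Set X))
    (h : ∀ x ∈ M, T x ∈ M) (hs : ∀ x ∈ M, ∃ y ∈ M, T y = x) : M ≤ analyticCore T := by
  have := hM.completeSpace_coe
  intro x hx
  -- Iterating a bounded right inverse, given by the open mapping theorem, yields a backward orbit.
  obtain ⟨g, hg⟩ := ContinuousLinearMap.exists_nonlinearRightInverse_of_surjective (T.restrict h)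
    (LinearMap.range_eq_top.2 fun y => by
      obtain ⟨z, hz, hzy⟩ := hs y y.2
      exact ⟨⟨z, hz⟩, Subtype.ext hzy⟩)
  set u : ℕ → M := fun n => g^[n] ⟨x, hx⟩ with hu
  have hsucc : ∀ n, u (n + 1) = g (u n) := fun n => Function.iterate_succ_apply' _ _ _
  refine mem_analyticCore_of_bound (u := fun n => (u n : X)) (C := ‖x‖) (δ := g.nnnorm)
    (by exact_mod_cast hg) rfl ?_ ?_
  · intro n
    rw [hsucc]
    exact congrArg Subtype.val (g.right_inv (u n))
  · intro n
    induction n with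
    | zero => simp [hu]
    | succ n ih =>
      rw [hsucc, pow_succ']
      calc ‖(g (u n) : X)‖ ≤ g.nnnorm * ‖u n‖ := g.bound _
        _ ≤ g.nnnorm * (‖x‖ * g.nnnorm ^ n) := by gcongr; exact ih
        _ = _ := by ring

theorem exists_continuousProjection {p q : Submodule ℂ X} (h : IsCompl p q)
    (hp : IsClosed (p : Set X)) (hq : IsClosed (q : Set X)) :
    ∃ P : X →L[ℂ] p, (∀ y : p, P y = y) ∧ (∀ y ∈ q, P y = 0) ∧ ∀ y, y - P y ∈ q := by
  have ht := Submodule.IsCompl.isTopCompl_of_isClosed h hp hq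
  refine ⟨p.projectionOntoL q ht, fun y => Submodule.projectionOntoL_apply_left ht y,
    fun y hy => Submodule.projectionOntoL_apply_right ht ⟨y, hy⟩, fun y => ?_⟩
  rw [← Submodule.projectionOntoL_apply_eq_zero_iff ht, map_sub,
    Submodule.projectionOntoL_apply_left, sub_self]

/-- A decomposition into a part that is mapped onto itself and a part inside the quasi-nilpotent
part makes the operator right generalized Drazin invertible. -/
theorem isRightGeneralizedDrazin_of_isCompl {M N : Submodule ℂ X} (hM : IsClosed (M : Set X))
    (hN : IsClosed (N : Set X)) (hMN : IsCompl M N) (hTM : ∀ x ∈ M, T x ∈ M)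
    (hs : ∀ x ∈ M, ∃ y ∈ M, T y = x) (hTN : ∀ x ∈ N, T x ∈ N)
    (hq : (N : Set X) ⊆ quasiNilpotentPart T) : IsRightGeneralizedDrazin T := by
  have hle := le_analyticCore hM hTM hs
  suffices heq : analyticCore T = M by
    rw [IsRightGeneralizedDrazin, heq]
    exact ⟨hM, N, hN, hMN, hTN, hq⟩
  have := hN.completeSpace_coe
  have hQ := isQuasiNilpotent_restrict hN hTN hq
  refine le_antisymm (fun x hx => ?_) hle
  -- The projection onto `N` along `M` commutes with `T`. It carries a backward orbit of `x` to one
  -- of `P x` in `N`, where its geometric growth cannot offset quasi-nilpotent decay.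
  obtain ⟨P, hPN, hPM, hdec⟩ := exists_continuousProjection hMN.symm hN hM
  have hPT : ∀ y, P (T y) = T.restrict hTN (P y) := by
    intro y
    have h1 : T y = (T.restrict hTN (P y) : N) + T (y - P y) := by simp
    rw [h1, map_add, hPN, hPM _ (hTM _ (hdec y)), add_zero]
  suffices hPx : P x = 0 by simpa [hPx] using hdec x
  obtain ⟨u, δ, hδ, h0, hu, hb⟩ := hx
  have hit : ∀ n, (T.restrict hTN ^ n) (P (u n)) = P x := by
    intro n
    induction n with
    | zero => simp [h0]
    | succ n ih =>
      rw [pow_succ, mul_apply_eq_comp, ← hPT, hu, ih]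
  have hlim : Tendsto (fun n : ℕ => (1 / 2 : ℝ) ^ n * (‖P‖ * ‖x‖)) atTop (𝓝 (0 * (‖P‖ * ‖x‖))) :=
    (tendsto_pow_atTop_nhds_zero_of_lt_one (by norm_num) (by norm_num)).mul_const _
  rw [zero_mul] at hlim
  refine norm_le_zero_iff.1 (ge_of_tendsto hlim ?_)
  filter_upwards [isQuasiNilpotent_iff.1 hQ (1 / 2 * δ⁻¹) (by positivity)] with n hn
  calc ‖P x‖ = ‖(T.restrict hTN ^ n) (P (u n))‖ := by rw [hit]
    _ ≤ (1 / 2 * δ⁻¹) ^ n * (‖P‖ * (δ ^ n * ‖x‖)) :=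
      ContinuousLinearMap.le_of_opNorm_le_of_le _ hn (P.le_opNorm_of_le (hb n))
    _ = _ := by rw [mul_pow, inv_pow]; field_simp

end AnalyticCore

/-! ### From Drazin to Weyl decompositions -/

section Weyl

variable {X : Type*} [NormedAddCommGroup X] [NormedSpace ℂ X]

theorem IsPseudoLowerSemiBWeyl.isPseudoLowerSemiBFredholm {T : X →L[ℂ] X}
    (h : IsPseudoLowerSemiBWeyl T) : IsPseudoLowerSemiBFredholm T := by
  obtain ⟨X₁, X₂, h₁, h₂, c₁, c₂, hc, hF, -, hQ⟩ := h
  exact ⟨X₁, X₂, h₁, h₂, c₁, c₂, hc, hF, hQ⟩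

theorem surjective_restrict_analyticCore (T : X →L[ℂ] X) :
    Function.Surjective
      (T.restrict fun _ h => map_mem_analyticCore h : analyticCore T →L[ℂ] analyticCore T) := by
  intro y
  obtain ⟨z, hz, hzy⟩ := exists_map_eq_of_mem_analyticCore y.2
  exact ⟨⟨z, hz⟩, Subtype.ext hzy⟩

theorem IsRightGeneralizedDrazin.isPseudoLowerSemiBWeyl [CompleteSpace X] {T : X →L[ℂ] X}
    (h : IsRightGeneralizedDrazin T) : IsPseudoLowerSemiBWeyl T := by
  obtain ⟨hK, N, hN, hKN, hTN, hq⟩ := h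
  have hr : (T.restrict fun _ h => map_mem_analyticCore h :
      analyticCore T →L[ℂ] analyticCore T).range = ⊤ :=
    LinearMap.range_eq_top.2 (surjective_restrict_analyticCore T)
  have hsub := Submodule.Quotient.subsingleton_iff.2 hr
  refine ⟨analyticCore T, N, fun _ h => map_mem_analyticCore h, hTN, hK, hN, hKN, ?_, ?_,
    isQuasiNilpotent_restrict hN hTN hq⟩
  · unfold IsLowerSemiFredholm
    infer_instance
  · unfold fredholmIndex
    rw [rank_subsingleton' ℂ (analyticCore T ⧸ _), map_zero, ENat.toENNReal_zero,
      EReal.coe_ennreal_zero, sub_zero]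
    exact EReal.coe_ennreal_nonneg _

end Weyl

/-! ### SVEP of the adjoint -/

section SVEP

variable {X : Type*} [NormedAddCommGroup X] [NormedSpace ℂ X]

theorem shift_banachAdjoint_apply (T : X →L[ℂ] X) (l z : ℂ) (φ : StrongDual ℂ X) (x : X) :
    shift (banachAdjoint T) z φ x = φ (shift T l x) - (z - l) * φ x := by
  simp only [shift, banachAdjoint, sub_apply, smul_apply, ContinuousLinearMap.coe_id', id_eq,
    ContinuousLinearMap.precomp_apply, ContinuousLinearMap.coe_comp, Function.comp_apply, map_sub,
    map_smul, smul_eq_mul]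
  ring

theorem IsRightGeneralizedDrazin.hasSVEPAt_banachAdjoint [CompleteSpace X] {T : X →L[ℂ] X} {l : ℂ}
    (h : IsRightGeneralizedDrazin (shift T l)) : HasSVEPAt (banachAdjoint T) l := by
  obtain ⟨hK, N, hN, hKN, hTN, hq⟩ := h
  have hQ := isQuasiNilpotent_restrict hN hTN hq
  have := hK.completeSpace_coe
  have := hN.completeSpace_coe
  obtain ⟨g, hg⟩ := ContinuousLinearMap.exists_nonlinearRightInverse_of_surjective _
    (LinearMap.range_eq_top.2 (surjective_restrict_analyticCore (shift T l)))
  intro U hUo hUc hlU f hf hfU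
  have hfz : ∀ z ∈ U, ∀ x, f z (shift T l x) = (z - l) * f z x := fun z hz x => by
    rw [← sub_eq_zero, ← shift_banachAdjoint_apply, hfU z hz, zero_apply]
  -- By the identity theorem, vanishing on a punctured neighbourhood of `l` suffices.
  refine hf.eqOn_zero_of_preconnected_of_frequently_eq_zero hUc.isPreconnected hlU
    (Eventually.frequently ?_)
  have hU : ∀ᶠ z in 𝓝[≠] l, z ∈ U := mem_nhdsWithin_of_mem_nhds (hUo.mem_nhds hlU)
  have hsmall : ∀ᶠ z in 𝓝[≠] l, ‖z - l‖ * g.nnnorm < 1 := by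
    have hc : ContinuousAt (fun z : ℂ => ‖z - l‖ * g.nnnorm) l := by fun_prop
    exact (hc.eventually_lt_const (by simp)).filter_mono nhdsWithin_le_nhds
  filter_upwards [hU, hsmall, self_mem_nhdsWithin] with z hz hzs hzl
  have hKz : (f z).domRestrict (analyticCore (shift T l)) = 0 := by
    set φ := (f z).domRestrict (analyticCore (shift T l)) with hφ
    have hle : ‖φ‖ ≤ ‖z - l‖ * g.nnnorm * ‖φ‖ := by
      refine φ.opNorm_le_bound (by positivity) fun x => ?_
      have hx : φ x = (z - l) * φ (g x) := by
        refine Eq.trans ?_ (hfz z hz (g x))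
        exact congrArg (fun w : analyticCore (shift T l) => f z w) (g.right_inv x).symm
      calc ‖φ x‖ = ‖z - l‖ * ‖φ (g x)‖ := by rw [hx, norm_mul]
        _ ≤ ‖z - l‖ * (‖φ‖ * (g.nnnorm * ‖x‖)) := by
          gcongr; exact φ.le_opNorm_of_le (g.bound x)
        _ = _ := by ring
    exact (ContinuousLinearMap.opNorm_zero_iff φ).1 (by nlinarith [norm_nonneg φ])
  have hNz : ∀ x ∈ N, f z x = 0 := by
    intro x hx
    -- For `z ≠ l` every vector of `N` is in the range of `T - z`, which `f z` annihilates.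
    obtain ⟨y, hy⟩ := hQ.surjective_sub_smul (sub_ne_zero.2 hzl) ⟨x, hx⟩
    have hy' : shift T l y - (z - l) • (y : X) = x := congrArg Subtype.val hy
    rw [← hy', map_sub, map_smul, hfz z hz, smul_eq_mul, sub_self]
  ext x
  obtain ⟨k, hk, n, hn, rfl⟩ := Submodule.mem_sup.1
    (hKN.sup_eq_top.symm ▸ Submodule.mem_top : x ∈ analyticCore (shift T l) ⊔ N)
  rw [map_add, hNz n hn, add_zero]
  exact congrArg (fun φ : analyticCore (shift T l) →L[ℂ] ℂ => φ ⟨k, hk⟩) hKz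

end SVEP

/-! ### Linear algebra of ranges and generalized kernels -/

section Algebra

variable {V : Type*} [AddCommGroup V] [Module ℂ V]

/-- The quotient map by `p` has a linear section that sends the image of `W` into `W`. -/
theorem exists_section_mkQ_mem (p W : Submodule ℂ V) :
    ∃ s : (V ⧸ p) →ₗ[ℂ] V, (∀ q, p.mkQ (s q) = q) ∧ ∀ w ∈ W, s (p.mkQ w) ∈ W := by
  obtain ⟨s₀, hs₀⟩ := p.mkQ.exists_rightInverse_of_surjective p.range_mkQ
  obtain ⟨τ, hτ⟩ := (p.mkQ.submoduleMap W).exists_rightInverse_of_surjective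
    (LinearMap.range_eq_top.2 (p.mkQ.submoduleMap_surjective W))
  have hs₀' : ∀ q, p.mkQ (s₀ q) = q := fun q => LinearMap.congr_fun hs₀ q
  have hτ' : ∀ q, p.mkQ (τ q : V) = q := fun q => congrArg Subtype.val (LinearMap.congr_fun hτ q)
  -- A section over the image of `W` differs from `s₀` by a `p`-valued map; extending that map
  -- corrects `s₀` globally.
  obtain ⟨D, hD⟩ := LinearMap.exists_extend
    ((W.subtype ∘ₗ τ - s₀ ∘ₗ (W.map p.mkQ).subtype).codRestrict p fun q => by
      refine (Submodule.Quotient.mk_eq_zero p).1 (show p.mkQ _ = 0 from ?_)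
      simp [- Submodule.mkQ_apply, hs₀', hτ'])
  refine ⟨s₀ + p.subtype ∘ₗ D, fun q => ?_, fun w hw => ?_⟩
  · have : p.mkQ (D q : V) = 0 := by simp
    rw [LinearMap.add_apply, map_add, hs₀', LinearMap.comp_apply, Submodule.subtype_apply, this,
      add_zero]
  · have h1 := congrArg Subtype.val (LinearMap.congr_fun hD ⟨p.mkQ w, w, hw, rfl⟩)
    have h2 : (D (p.mkQ w) : V) = τ ⟨p.mkQ w, w, hw, rfl⟩ - s₀ (p.mkQ w) := h1
    rw [LinearMap.add_apply, LinearMap.comp_apply, Submodule.subtype_apply, h2, add_sub_cancel]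
    exact Subtype.property _

/-- If `A` maps `M` onto itself and is nilpotent modulo `M`, then `M` has an `A`-invariant
complement. -/
theorem exists_isCompl_invariant {A : V →ₗ[ℂ] V} {M : Submodule ℂ V} (hM : ∀ x ∈ M, A x ∈ M)
    (hs : ∀ x ∈ M, ∃ y ∈ M, A y = x) {d : ℕ} (hd : ∀ x, (A ^ d) x ∈ M) :
    ∃ F : Submodule ℂ V, IsCompl M F ∧ ∀ x ∈ F, A x ∈ F := by
  obtain ⟨R, hR⟩ := (A.restrict hM).exists_rightInverse_of_surjective
    (LinearMap.range_eq_top.2 fun y => by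
      obtain ⟨z, hz, hzy⟩ := hs y y.2
      exact ⟨⟨z, hz⟩, Subtype.ext hzy⟩)
  have hR' : ∀ m, A.restrict hM (R m) = m := fun m => LinearMap.congr_fun hR m
  obtain ⟨p, hp⟩ := M.subtype.exists_leftInverse_of_injective M.ker_subtype
  have hp' : ∀ m : M, p m = m := fun m => LinearMap.congr_fun hp m
  -- `δ` measures how far `p` is from commuting with `A`. The sum in `π` telescopes this defect
  -- away, stopping at `d` because `δ` vanishes on `M`, which contains the range of `A ^ d`.
  set δ : V →ₗ[ℂ] M := p ∘ₗ A - A.restrict hM ∘ₗ p with hδ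
  have hδM : ∀ m ∈ M, δ m = 0 := by
    intro m hm
    have h1 : p (A m) = ⟨A m, hM m hm⟩ := hp' ⟨A m, hM m hm⟩
    have h2 : p m = ⟨m, hm⟩ := hp' ⟨m, hm⟩
    simp only [hδ, LinearMap.sub_apply, LinearMap.comp_apply, h1, h2, sub_eq_zero]
    rfl
  have hMpow : ∀ j, ∀ m ∈ M, (A ^ j) m ∈ M := by
    intro j
    induction j with
    | zero => exact fun m hm => hm
    | succ j ih => exact fun m hm => by rw [pow_succ]; exact ih _ (hM m hm)
  set π : V →ₗ[ℂ] M := p + ∑ j ∈ Finset.range d, (R ^ (j + 1)) ∘ₗ δ ∘ₗ (A ^ j) with hπ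
  have hπ_apply : ∀ x, π x = p x + ∑ j ∈ Finset.range d, (R ^ (j + 1)) (δ ((A ^ j) x)) := by
    intro x
    simp [hπ, LinearMap.sum_apply]
  have hπM : ∀ m : M, π m = m := by
    intro m
    rw [hπ_apply, hp', Finset.sum_eq_zero, add_zero]
    intro j _
    rw [hδM _ (hMpow j m m.2), map_zero]
  have hcomm : ∀ x, π (A x) = A.restrict hM (π x) := by
    intro x
    have h1 : ∀ j, A.restrict hM ((R ^ (j + 1)) (δ ((A ^ j) x))) = (R ^ j) (δ ((A ^ j) x)) := by
      intro j
      rw [pow_succ', Module.End.mul_apply, hR']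
    have h2 : ∀ j, (R ^ (j + 1)) (δ ((A ^ j) (A x))) = (R ^ (j + 1)) (δ ((A ^ (j + 1)) x)) := by
      intro j
      rw [pow_succ A, Module.End.mul_apply]
    rw [hπ_apply, hπ_apply, map_add, map_sum]
    simp_rw [h1, h2]
    have h3 := Finset.sum_range_succ (fun j => (R ^ j) (δ ((A ^ j) x))) d
    rw [Finset.sum_range_succ', hδM _ (hd x), map_zero, add_zero] at h3
    rw [← h3]
    simp only [hδ, LinearMap.sub_apply, LinearMap.comp_apply, pow_zero, Module.End.one_apply]
    abel
  refine ⟨LinearMap.ker π, LinearMap.isCompl_of_proj hπM, fun x hx => ?_⟩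
  rw [LinearMap.mem_ker] at hx ⊢
  rw [hcomm, hx, map_zero]

/-- If `V = R(A) + F₁ = R(A^n) + F`, then `V = R(A^(n+1)) + A F + F₁`. -/
theorem finiteDimensional_quotient_range_pow {A : V →ₗ[ℂ] V}
    (h : FiniteDimensional ℂ (V ⧸ LinearMap.range A)) (n : ℕ) :
    FiniteDimensional ℂ (V ⧸ LinearMap.range (A ^ n)) := by
  induction n with
  | zero => rw [pow_zero, Module.End.one_eq_id, LinearMap.range_id]; infer_instance
  | succ n ih =>
    obtain ⟨F₁, hF₁⟩ := (LinearMap.range A).exists_isCompl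
    obtain ⟨F, hF⟩ := (LinearMap.range (A ^ n)).exists_isCompl
    have hfg : (F₁ ⊔ F.map A).FG :=
      (Submodule.CoFG.fg_of_isCompl hF₁ h).sup ((Submodule.CoFG.fg_of_isCompl hF ih).map A)
    refine Submodule.FG.cofg_of_codisjoint ?_ hfg
    rw [codisjoint_iff, eq_top_iff]
    rintro x -
    obtain ⟨_, ⟨y, rfl⟩, f₁, hf₁, rfl⟩ := Submodule.mem_sup.1
      (hF₁.sup_eq_top.symm ▸ Submodule.mem_top : x ∈ LinearMap.range A ⊔ F₁)
    obtain ⟨_, ⟨w, rfl⟩, f, hf, rfl⟩ := Submodule.mem_sup.1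
      (hF.sup_eq_top.symm ▸ Submodule.mem_top : y ∈ LinearMap.range (A ^ n) ⊔ F)
    rw [map_add, add_assoc]
    refine Submodule.add_mem _ (Submodule.mem_sup_right ⟨w, ?_⟩) (Submodule.mem_sup_left
      (Submodule.add_mem _ (Submodule.mem_sup_right ⟨f, hf, rfl⟩) (Submodule.mem_sup_left hf₁)))
    rw [pow_succ']
    rfl

theorem mem_maxGenEigenspace_zero {A : V →ₗ[ℂ] V} {x : V} :
    x ∈ Module.End.maxGenEigenspace A 0 ↔ ∃ k, (A ^ k) x = 0 := by
  rw [Module.End.mem_maxGenEigenspace, zero_smul, sub_zero]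

/-- The increasing images of `ker (A ^ n)` in the finite-dimensional quotient by the range
stabilize. -/
theorem exists_range_sup_ker_pow_eq_top {A : V →ₗ[ℂ] V}
    (h : FiniteDimensional ℂ (V ⧸ LinearMap.range A))
    (ht : LinearMap.range A ⊔ Module.End.maxGenEigenspace A 0 = ⊤) :
    ∃ d : ℕ, LinearMap.range A ⊔ LinearMap.ker (A ^ d) = ⊤ := by
  have hmono : Monotone fun n : ℕ => (LinearMap.ker (A ^ n)) := by
    intro m n hmn x hx
    rw [LinearMap.mem_ker] at hx ⊢
    rw [← Nat.sub_add_cancel hmn, pow_add, Module.End.mul_apply, hx, map_zero]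
  obtain ⟨d, hd⟩ := monotone_stabilizes_iff_noetherian.2
    (inferInstance : IsNoetherian ℂ (V ⧸ LinearMap.range A))
    ⟨fun n => (LinearMap.ker (A ^ n)).map (LinearMap.range A).mkQ,
      fun m n hmn => Submodule.map_mono (hmono hmn)⟩
  refine ⟨d, eq_top_iff.2 fun x _ => ?_⟩
  obtain ⟨r, hr, v, hv, rfl⟩ := Submodule.mem_sup.1
    (ht.symm ▸ Submodule.mem_top : x ∈ LinearMap.range A ⊔ Module.End.maxGenEigenspace A 0)
  refine add_mem (Submodule.mem_sup_left hr) ?_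
  obtain ⟨k, hk⟩ := mem_maxGenEigenspace_zero.1 hv
  have h1 : (LinearMap.range A).mkQ v ∈
      (LinearMap.ker (A ^ max d k)).map (LinearMap.range A).mkQ :=
    ⟨v, hmono (le_max_right d k) (LinearMap.mem_ker.2 hk), rfl⟩
  rw [show (LinearMap.ker (A ^ max d k)).map (LinearMap.range A).mkQ =
    (LinearMap.ker (A ^ d)).map (LinearMap.range A).mkQ from (hd _ (le_max_left d k)).symm] at h1
  obtain ⟨w, hw, hwv⟩ := h1
  have h2 : v - w ∈ LinearMap.range A := by
    rw [← Submodule.ker_mkQ (LinearMap.range A), LinearMap.mem_ker, map_sub, hwv, sub_self]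
  rw [← sub_add_cancel v w]
  exact add_mem (Submodule.mem_sup_left h2) (Submodule.mem_sup_right hw)

end Algebra

/-! ### Lower semi-Fredholm operators -/

section LowerSemiFredholm

variable {Y : Type*} [NormedAddCommGroup Y] [NormedSpace ℂ Y] [CompleteSpace Y] {A : Y →L[ℂ] Y}

/-- Relative to any section of the quotient map by its range, a lower semi-Fredholm operator has a
bounded, not necessarily linear, right inverse; and its range is closed. -/
theorem IsLowerSemiFredholm.exists_rightInverse (h : IsLowerSemiFredholm A)
    (s : (Y ⧸ A.range) →ₗ[ℂ] Y) (hs : ∀ q, A.range.mkQ (s q) = q) :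
    IsClosed (A.range : Set Y) ∧ ∃ (g : Y → Y) (C : ℝ), 0 < C ∧ (∀ y, ‖g y‖ ≤ C * ‖y‖) ∧
      ∀ y, A (g y) = y - s (A.range.mkQ y) := by
  have : FiniteDimensional ℂ (Y ⧸ A.range) := h
  set e := (Module.finBasis ℂ (Y ⧸ A.range)).equivFun
  set S : (Fin (Module.finrank ℂ (Y ⧸ A.range)) → ℂ) →L[ℂ] Y :=
    LinearMap.toContinuousLinearMap (s ∘ₗ e.symm.toLinearMap) with hS
  have hSe : ∀ q, S (e q) = s q := fun q => by simp [hS]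
  have hAq : ∀ x, A.range.mkQ (A x) = 0 := fun x => by
    rw [← LinearMap.mem_ker, Submodule.ker_mkQ]
    exact ⟨x, rfl⟩
  have hmk : ∀ x c, e (A.range.mkQ (A x + S c)) = c := by
    intro x c
    obtain ⟨q, rfl⟩ := e.surjective c
    rw [map_add, hAq, zero_add, hSe, hs]
  -- Adjoining a finite-dimensional complement makes `A` onto. The second component of a preimage is
  -- forced to be the coordinates of the class of `y`.
  obtain ⟨G, hG⟩ := ContinuousLinearMap.exists_nonlinearRightInverse_of_surjective (A.coprod S)
    (LinearMap.range_eq_top.2 fun y => by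
      have : y - s (A.range.mkQ y) ∈ A.range := by
        refine (Submodule.Quotient.mk_eq_zero A.range).1 (show A.range.mkQ _ = 0 from ?_)
        rw [map_sub, hs, sub_self]
      obtain ⟨x, hx⟩ := this
      refine ⟨(x, e (A.range.mkQ y)), ?_⟩
      change A x + S (e (A.range.mkQ y)) = y
      rw [hSe, show A x = y - s (A.range.mkQ y) from hx, sub_add_cancel])
  have hGr : ∀ y, A (G y).1 + S (G y).2 = y := fun y => G.right_inv y
  have hG2 : ∀ y, (G y).2 = e (A.range.mkQ y) := fun y => by
    conv_rhs => rw [← hGr y]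
    rw [hmk]
  constructor
  -- The bound on `G` makes these coordinates continuous, so the range is a closed kernel.
  · set c : Y →L[ℂ] (Fin (Module.finrank ℂ (Y ⧸ A.range)) → ℂ) :=
      (e.toLinearMap ∘ₗ A.range.mkQ).mkContinuous G.nnnorm fun y =>
        (show ‖e (A.range.mkQ y)‖ ≤ _ by
          rw [← hG2]
          exact (norm_snd_le _).trans (G.bound y)) with hc
    have hker : A.range = c.ker := by
      ext y
      rw [LinearMap.mem_ker]
      change y ∈ A.range ↔ e (A.range.mkQ y) = 0
      rw [LinearEquiv.map_eq_zero_iff, ← LinearMap.mem_ker, Submodule.ker_mkQ]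
    rw [hker]
    exact c.isClosed_ker
  · refine ⟨fun y => (G y).1, G.nnnorm, by exact_mod_cast hG,
      fun y => (norm_fst_le _).trans (G.bound y), fun y => ?_⟩
    rw [eq_sub_iff_add_eq, ← hSe, ← hG2, hGr]

theorem IsLowerSemiFredholm.isClosed_range (h : IsLowerSemiFredholm A) :
    IsClosed (A.range : Set Y) := by
  obtain ⟨s, hs, -⟩ := exists_section_mkQ_mem A.range ⊥
  exact (h.exists_rightInverse s hs).1

/-- Functionals that vanish on the generalized kernel have preimages under the adjoint that vanish
there too, with a uniform bound on the norm. -/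
theorem IsLowerSemiFredholm.exists_adjoint_preimage (h : IsLowerSemiFredholm A) :
    ∃ C : ℝ, 0 < C ∧ ∀ φ : StrongDual ℂ Y,
      (∀ v ∈ Module.End.maxGenEigenspace (A : Y →ₗ[ℂ] Y) 0, φ v = 0) →
        ∃ ψ : StrongDual ℂ Y, (∀ v ∈ Module.End.maxGenEigenspace (A : Y →ₗ[ℂ] Y) 0, ψ v = 0) ∧
          (∀ x, ψ (A x) = φ x) ∧ ‖ψ‖ ≤ C * ‖φ‖ := by
  set N := Module.End.maxGenEigenspace (A : Y →ₗ[ℂ] Y) 0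
  have hN : ∀ x, A x ∈ N → x ∈ N := fun x hx => by
    obtain ⟨k, hk⟩ := mem_maxGenEigenspace_zero.1 hx
    exact mem_maxGenEigenspace_zero.2 ⟨k + 1, by rw [pow_succ]; exact hk⟩
  -- A section preserving `N` makes `g` map `N` into `N`, so `φ ∘ g` again vanishes on `N`.
  obtain ⟨s, hs, hsN⟩ := exists_section_mkQ_mem A.range N
  obtain ⟨-, g, C, hC, hgC, hg⟩ := h.exists_rightInverse s hs
  refine ⟨C, hC, fun φ hφ => ?_⟩
  have hφA : ∀ x y, A x = A y → φ x = φ y := fun x y hxy => by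
    rw [← sub_eq_zero, ← map_sub]
    exact hφ _ (hN _ (by rw [map_sub, hxy, sub_self]; exact zero_mem _))
  -- Although `g` need not be linear, `φ ∘ g` is: `φ` kills the kernel of `A`.
  let ψ : Y →ₗ[ℂ] ℂ :=
    { toFun := fun y => φ (g y)
      map_add' := fun x y => by
        rw [← map_add]
        refine hφA _ _ ?_
        rw [map_add, hg, hg, hg, map_add, map_add]
        abel
      map_smul' := fun c x => by
        rw [RingHom.id_apply, ← map_smul]
        refine hφA _ _ ?_
        rw [map_smul, hg, hg, map_smul, map_smul, smul_sub] }
  refine ⟨ψ.mkContinuous (C * ‖φ‖) fun y => ?_, fun v hv => hφ _ (hN _ ?_), fun x => hφA _ _ ?_,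
    LinearMap.mkContinuous_norm_le _ (by positivity) _⟩
  · calc ‖φ (g y)‖ ≤ ‖φ‖ * (C * ‖y‖) := φ.le_opNorm_of_le (hgC y)
      _ = C * ‖φ‖ * ‖y‖ := by ring
  · rw [hg]
    exact sub_mem hv (hsN v hv)
  · have : A.range.mkQ (A x) = 0 := by
      rw [← LinearMap.mem_ker, Submodule.ker_mkQ]
      exact ⟨x, rfl⟩
    rw [hg, this, map_zero, sub_zero]

theorem IsLowerSemiFredholm.exists_functionals (h : IsLowerSemiFredholm A)
    (hne : A.range ⊔ Module.End.maxGenEigenspace (A : Y →ₗ[ℂ] Y) 0 ≠ ⊤) :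
    ∃ (φ : ℕ → StrongDual ℂ Y) (C : ℝ), 0 < C ∧ φ 0 ≠ 0 ∧ (∀ x, φ 0 (A x) = 0) ∧
      (∀ n x, φ (n + 1) (A x) = φ n x) ∧ ∀ n, ‖φ n‖ ≤ C ^ n * ‖φ 0‖ := by
  obtain ⟨f, hf, hfker⟩ := Submodule.exists_le_ker_of_lt_top _ (lt_top_iff_ne_top.2 hne)
  obtain ⟨C, hC, hstep⟩ := h.exists_adjoint_preimage
  choose F hF0 hFA hFC using hstep
  have hfA : A.range ≤ LinearMap.ker f := le_sup_left.trans hfker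
  -- `f` factors through the quotient by the closed range, which is finite-dimensional.
  have hcont : Continuous f := by
    have : FiniteDimensional ℂ (Y ⧸ A.range) := h
    have : IsClosed (A.range : Set Y) := h.isClosed_range
    have h1 : Continuous (A.range.liftQ f hfA) := LinearMap.continuous_of_finiteDimensional _
    exact h1.comp A.range.mkQL.continuous
  let φ : ℕ → {φ : StrongDual ℂ Y //
      ∀ v ∈ Module.End.maxGenEigenspace (A : Y →ₗ[ℂ] Y) 0, φ v = 0} := fun n =>
    Nat.rec ⟨⟨f, hcont⟩, fun v hv => hfker (Submodule.mem_sup_right hv)⟩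
      (fun _ p => ⟨F p.1 p.2, hF0 p.1 p.2⟩) n
  refine ⟨fun n => (φ n).1, C, hC, fun h0 => hf ?_, fun x => hfA ⟨x, rfl⟩,
    fun n x => hFA _ (φ n).2 x, fun n => ?_⟩
  · ext x
    exact congrArg (fun ψ : StrongDual ℂ Y => ψ x) h0
  · induction n with
    | zero => simp
    | succ n ih =>
      calc ‖(φ (n + 1)).1‖ ≤ C * ‖(φ n).1‖ := hFC _ (φ n).2
        _ ≤ C * (C ^ n * ‖(φ 0).1‖) := by gcongr
        _ = _ := by ring

theorem IsLowerSemiFredholm.exists_decomposition (h : IsLowerSemiFredholm A)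
    (ht : A.range ⊔ Module.End.maxGenEigenspace (A : Y →ₗ[ℂ] Y) 0 = ⊤) :
    ∃ (M F : Submodule ℂ Y) (d : ℕ), IsClosed (M : Set Y) ∧ F.FG ∧ IsCompl M F ∧
      (∀ x ∈ M, A x ∈ M) ∧ (∀ x ∈ M, ∃ y ∈ M, A y = x) ∧ (∀ x ∈ F, A x ∈ F) ∧
        ∀ x ∈ F, (A ^ d) x = 0 := by
  obtain ⟨d, hd⟩ := exists_range_sup_ker_pow_eq_top h ht
  have hpow : ∀ n x, ((A : Y →ₗ[ℂ] Y) ^ n) x = (A ^ n) x := fun n x => by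
    rw [Module.End.pow_apply, FunLike.coe_pow_eq_iterate]
    rfl
  have hfin := finiteDimensional_quotient_range_pow h d
  have hrange : LinearMap.range ((A : Y →ₗ[ℂ] Y) ^ d) = (A ^ d).range := by
    ext y
    exact exists_congr fun x => by rw [hpow]; rfl
  have hMA : ∀ x ∈ (A ^ d).range, A x ∈ (A ^ d).range := by
    rintro _ ⟨y, rfl⟩
    refine ⟨A y, ?_⟩
    change (A ^ d * A) y = (A * A ^ d) y
    rw [← pow_succ, ← pow_succ']
  have hMs : ∀ x ∈ (A ^ d).range, ∃ y ∈ (A ^ d).range, A y = x := by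
    rintro _ ⟨y, rfl⟩
    obtain ⟨_, ⟨w, rfl⟩, v, hv, rfl⟩ := Submodule.mem_sup.1
      (hd.symm ▸ Submodule.mem_top : y ∈ A.range ⊔ LinearMap.ker ((A : Y →ₗ[ℂ] Y) ^ d))
    rw [LinearMap.mem_ker, hpow] at hv
    refine ⟨(A ^ d) w, ⟨w, rfl⟩, ?_⟩
    change (A * A ^ d) w = (A ^ d) (A w + v)
    -- With `y = A w + v` and `A ^ d v = 0`, one has `A ^ d y = A (A ^ d w)`.
    rw [map_add, hv, add_zero, ← pow_succ', pow_succ]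
    rfl
  obtain ⟨F, hF, hFA⟩ := exists_isCompl_invariant (A := (A : Y →ₗ[ℂ] Y)) hMA hMs (d := d)
    fun x => ⟨x, (hpow d x).symm⟩
  rw [hrange] at hfin
  have hFpow : ∀ n, ∀ x ∈ F, (A ^ n) x ∈ F := by
    intro n
    induction n with
    | zero => exact fun x hx => hx
    | succ n ih => exact fun x hx => by rw [pow_succ]; exact ih _ (hFA x hx)
  exact ⟨(A ^ d).range, F, d, IsLowerSemiFredholm.isClosed_range hfin,
    Submodule.CoFG.fg_of_isCompl hF hfin, hF, hMA, hMs, hFA,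
    fun x hx => Submodule.disjoint_def.1 hF.disjoint _ ⟨x, rfl⟩ (hFpow d x hx)⟩

end LowerSemiFredholm

/-! ### Failure of SVEP and the main equivalence -/

section Main

variable {X : Type*} [NormedAddCommGroup X] [NormedSpace ℂ X] {T : X →L[ℂ] X} {l : ℂ}

/-- A geometrically bounded backward orbit of the shifted adjoint, starting at a nonzero element of
its kernel, destroys the single valued extension property. -/
theorem not_hasSVEPAt_banachAdjoint {Φ : ℕ → StrongDual ℂ X} {C D : ℝ} (hC : 0 < C)
    (h0 : Φ 0 ≠ 0) (hker : ∀ x, Φ 0 (shift T l x) = 0)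
    (hsucc : ∀ n x, Φ (n + 1) (shift T l x) = Φ n x) (hb : ∀ n, ‖Φ n‖ ≤ C ^ n * D) :
    ¬ HasSVEPAt (banachAdjoint T) l := by
  intro hS
  -- On the disc of this radius the series is dominated by one of ratio `1 / 2`.
  have hr : 0 < (2 * C)⁻¹ := by positivity
  set f : ℂ → StrongDual ℂ X := fun z => ∑' n : ℕ, (z - l) ^ n • Φ n with hf
  have hu : Summable fun n : ℕ => (1 / 2 : ℝ) ^ n * D :=
    (summable_geometric_of_lt_one (by norm_num) (by norm_num)).mul_right D
  have hle : ∀ n z, z ∈ Metric.ball l (2 * C)⁻¹ → ‖(z - l) ^ n • Φ n‖ ≤ (1 / 2 : ℝ) ^ n * D := by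
    intro n z hz
    rw [Metric.mem_ball, dist_eq_norm] at hz
    rw [norm_smul, norm_pow]
    calc ‖z - l‖ ^ n * ‖Φ n‖ ≤ ((2 * C)⁻¹) ^ n * (C ^ n * D) := by
          gcongr
          exact hb n
      _ = (1 / 2 : ℝ) ^ n * D := by
        rw [← mul_assoc, ← mul_pow]
        congr 2
        field_simp
  have hsum : ∀ z ∈ Metric.ball l (2 * C)⁻¹, Summable fun n : ℕ => (z - l) ^ n • Φ n :=
    fun z hz => Summable.of_norm_bounded hu fun n => hle n z hz
  have han : AnalyticOnNhd ℂ f (Metric.ball l (2 * C)⁻¹) := by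
    refine DifferentiableOn.analyticOnNhd ?_ Metric.isOpen_ball
    refine Complex.differentiableOn_tsum_of_summable_norm hu (fun n => ?_) Metric.isOpen_ball hle
    fun_prop
  have hfz : ∀ z ∈ Metric.ball l (2 * C)⁻¹, shift (banachAdjoint T) z (f z) = 0 := by
    intro z hz
    have hev : ∀ x, HasSum (fun n : ℕ => (z - l) ^ n * Φ n x) (f z x) := fun x => by
      have h1 := (ContinuousLinearMap.apply ℂ ℂ x : StrongDual ℂ X →L[ℂ] ℂ).hasSum (hsum z hz).hasSum
      simpa only [ContinuousLinearMap.apply_apply, smul_apply, smul_eq_mul] using h1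
    ext x
    rw [shift_banachAdjoint_apply T l, zero_apply, sub_eq_zero]
    refine (hev (shift T l x)).unique ?_
    -- The zeroth term vanishes since `Φ 0` kills the range; the rest is the shifted series.
    rw [← hasSum_nat_add_iff' 1]
    simp only [hsucc, Finset.range_one, Finset.sum_singleton, hker, mul_zero, sub_zero]
    refine ((hev x).mul_left (z - l)).congr_fun fun n => ?_
    ring
  have hl := hS _ Metric.isOpen_ball
    ⟨⟨l, Metric.mem_ball_self hr⟩, (convex_ball l _).isPreconnected⟩ (Metric.mem_ball_self hr) f han hfz
    l (Metric.mem_ball_self hr)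
  refine h0 ?_
  rw [← hl, hf]
  simp only [sub_self]
  rw [tsum_eq_single 0 fun n hn => by
    rw [zero_pow hn]; exact zero_smul ℂ (Φ n), pow_zero, one_smul]

variable [CompleteSpace X]

theorem IsPseudoLowerSemiBFredholm.isRightGeneralizedDrazin
    (h : IsPseudoLowerSemiBFredholm (shift T l)) (hS : HasSVEPAt (banachAdjoint T) l) :
    IsRightGeneralizedDrazin (shift T l) := by
  obtain ⟨X₁, X₂, h₁, h₂, c₁, c₂, hc, hF, hQ⟩ := h
  have := c₁.completeSpace_coe
  have := c₂.completeSpace_coe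
  obtain ⟨P, hP₁, hP₂, hPd⟩ := exists_continuousProjection hc c₁ c₂
  have hPT : ∀ x, P (shift T l x) = (shift T l).restrict h₁ (P x) := by
    intro x
    have h3 : shift T l x = ((shift T l).restrict h₁ (P x) : X₁) + shift T l (x - P x) := by simp
    conv_lhs => rw [h3, map_add, hP₁, hP₂ _ (h₂ _ (hPd x)), add_zero]
  have ht : ((shift T l).restrict h₁).range ⊔
      Module.End.maxGenEigenspace ((shift T l).restrict h₁ : X₁ →ₗ[ℂ] X₁) 0 = ⊤ := by
    by_contra hne
    obtain ⟨φ, C, hC, h0, hker, hsucc, hb⟩ := hF.exists_functionals hne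
    refine not_hasSVEPAt_banachAdjoint (Φ := fun n => (φ n).comp P) (D := ‖φ 0‖ * ‖P‖) hC
      (fun hz => h0 ?_) (fun x => ?_) (fun n x => ?_) (fun n => ?_) hS
    · ext x
      have := congrArg (fun ψ : StrongDual ℂ X => ψ x) hz
      simpa [hP₁] using this
    · rw [ContinuousLinearMap.comp_apply, hPT, hker]
    · rw [ContinuousLinearMap.comp_apply, hPT, hsucc, ContinuousLinearMap.comp_apply]
    · calc ‖(φ n).comp P‖ ≤ ‖φ n‖ * ‖P‖ := (φ n).opNorm_comp_le P
        _ ≤ C ^ n * ‖φ 0‖ * ‖P‖ := by gcongr; exact hb n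
        _ = _ := by ring
  obtain ⟨M, F, d, hMc, hFfg, hMF, hMA, hMs, hFA, hFd⟩ := hF.exists_decomposition ht
  have hFfin : FiniteDimensional ℂ (F.map X₁.subtype) := Module.Finite.iff_fg.2 (hFfg.map _)
  -- The nilpotent summand `F` joins the quasi-nilpotent part; its finite dimension keeps the sum
  -- closed.
  refine isRightGeneralizedDrazin_of_isCompl (M := M.map X₁.subtype) (N := X₂ ⊔ F.map X₁.subtype)
    (c₁.isClosedEmbedding_subtypeVal.isClosedMap _ hMc)
    (Submodule.isClosed_sup_finiteDimensional _ _ c₂) ⟨?_, ?_⟩ ?_ ?_ ?_ ?_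
  · rw [Submodule.disjoint_def]
    rintro _ ⟨m, hm, rfl⟩ hx
    obtain ⟨y, hy, _, ⟨f, hf, rfl⟩, hyf⟩ := Submodule.mem_sup.1 hx
    have hy1 : y ∈ X₁ := by
      rw [eq_sub_of_add_eq hyf]
      exact sub_mem m.2 f.2
    rw [Submodule.disjoint_def.1 hc.disjoint y hy1 hy, zero_add] at hyf
    rw [Subtype.val_injective hyf] at hf
    rw [Submodule.disjoint_def.1 hMF.disjoint m hm hf, map_zero]
  · rw [codisjoint_iff, eq_top_iff]
    rintro x -
    obtain ⟨x₁, hx₁, x₂, hx₂, rfl⟩ := Submodule.mem_sup.1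
      (hc.sup_eq_top.symm ▸ Submodule.mem_top : x ∈ X₁ ⊔ X₂)
    obtain ⟨m, hm, f, hf, hmf⟩ := Submodule.mem_sup.1
      (hMF.sup_eq_top.symm ▸ Submodule.mem_top : (⟨x₁, hx₁⟩ : X₁) ∈ M ⊔ F)
    have hmf' : (m : X) + f = x₁ := congrArg Subtype.val hmf
    rw [← hmf', add_assoc]
    exact Submodule.add_mem _ (Submodule.mem_sup_left ⟨m, hm, rfl⟩)
      (Submodule.mem_sup_right (Submodule.add_mem _ (Submodule.mem_sup_right ⟨f, hf, rfl⟩)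
        (Submodule.mem_sup_left hx₂)))
  · rintro _ ⟨m, hm, rfl⟩
    exact ⟨_, hMA m hm, rfl⟩
  · rintro _ ⟨m, hm, rfl⟩
    obtain ⟨y, hy, hym⟩ := hMs m hm
    exact ⟨y, ⟨y, hy, rfl⟩, congrArg Subtype.val hym⟩
  · intro x hx
    obtain ⟨y, hy, _, ⟨f, hf, rfl⟩, rfl⟩ := Submodule.mem_sup.1 hx
    rw [map_add]
    exact Submodule.add_mem _ (Submodule.mem_sup_left (h₂ y hy))
      (Submodule.mem_sup_right ⟨_, hFA f hf, rfl⟩)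
  · intro x hx
    obtain ⟨y, hy, _, ⟨f, hf, rfl⟩, rfl⟩ := Submodule.mem_sup.1 hx
    have hyq := (mem_quasiNilpotentPart_restrict h₂ ⟨y, hy⟩).1 (hQ.mem_quasiNilpotentPart _)
    rw [mem_quasiNilpotentPart_iff] at hyq ⊢
    intro ε hε
    filter_upwards [hyq ε hε, eventually_ge_atTop d] with n hn hdn
    have hfn : (shift T l ^ n) (f : X) = 0 := by
      rw [← Nat.sub_add_cancel hdn, pow_add, mul_apply_eq_comp, ← restrict_pow_apply h₁ d f,
        hFd f hf, Submodule.coe_zero, map_zero]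
    rw [map_add, Submodule.subtype_apply, hfn, add_zero]
    exact hn

end Main

end PseudoFredholm

end

theorem mainTheorem2 {X : Type*} [NormedAddCommGroup X] [NormedSpace ℂ X] [CompleteSpace X]
    (T : X →L[ℂ] X) :
    PseudoFredholm.spectrumRGD T =
        PseudoFredholm.spectrumPBLF T ∪
          PseudoFredholm.svepFailureSet (PseudoFredholm.banachAdjoint T) ∧
      PseudoFredholm.spectrumPBLF T ∪
          PseudoFredholm.svepFailureSet (PseudoFredholm.banachAdjoint T) =
        PseudoFredholm.spectrumPBLW T ∪
          PseudoFredholm.svepFailureSet (PseudoFredholm.banachAdjoint T) := by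
  have h1 : PseudoFredholm.spectrumRGD T ⊆ PseudoFredholm.spectrumPBLF T ∪
      PseudoFredholm.svepFailureSet (PseudoFredholm.banachAdjoint T) := by
    intro l hl
    by_contra hn
    rw [Set.mem_union, not_or] at hn
    exact hl ((not_not.1 hn.1).isRightGeneralizedDrazin (not_not.1 hn.2))
  have h2 : PseudoFredholm.spectrumPBLF T ⊆ PseudoFredholm.spectrumPBLW T :=
    fun l hl hW => hl hW.isPseudoLowerSemiBFredholm
  have h3 : PseudoFredholm.spectrumPBLW T ∪
      PseudoFredholm.svepFailureSet (PseudoFredholm.banachAdjoint T) ⊆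
        PseudoFredholm.spectrumRGD T := by
    rintro l (hl | hl) hR
    · exact hl hR.isPseudoLowerSemiBWeyl
    · exact hl hR.hasSVEPAt_banachAdjoint
  have h4 := Set.union_subset_union_left
    (PseudoFredholm.svepFailureSet (PseudoFredholm.banachAdjoint T)) h2
  exact ⟨h1.antisymm (h4.trans h3), h4.antisymm (h3.trans h1)⟩
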